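/- **Conventions.** A signature $\sigma$ is a finite set of relation symbols, each of positive arity. A $\sigma$-structure $\mathbf A$ consists of a finite set $A$ and a relation $R(\mathbf A)\subseteq A^{\mathrm{arity}(R)}$ for every $R\in\sigma$. Its constraints are the elements $R(\mathbf a)$ (formally, pairs $(\mathbf a,R)$) of $\mathcal C_{\mathbf A}=\{(\mathbf a,R) : R\in\sigma,\ \mathbf a\in R(\mathbf A)\}$, and $\{\mathbf a\}$ is the set of entries of $\mathbf a$. Let $k\ge 1$. **The system $\mathrm{SA}^k(\mathbf A,\mathbf B)$.** It has a variable $p_V(f)\in[0,1]$ for every $V\subseteq A$ with $1\le|V|\le k$ and every $f:V\to B$, and a variable $p_{R(\mathbf a)}(f)\in[0,1]$ for every $R(\mathbf a)\in\mathcal C_{\mathbf A}$ and every $f:\{\mathbf a\}\to B$. Its constraints are, where $U$ and $V$ are nonempty: 1. $\sum_{f:V\to B}p_V(f)=1$ for all $V\subseteq A$ with $|V|\le k$; 2. $p_U(f)=\sum_{g:V\to B,\ g|_U=f}p_V(g)$ for all $U\subseteq V\subseteq A$ with $|V|\le k$ and all $f:U\to B$; 3. $p_U(f)=\sum_{g:\{\mathbf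 a\}\to B,\ g|_U=f}p_{R(\mathbf a)}(g)$ for all $R(\mathbf a)\in\mathcal C_{\mathbf A}$, all $U\subseteq\{\mathbf a\}$ with $|U|\le k$ and all $f:U\to B$; 4. $p_{R(\mathbf a)}(f)=0$ for all $R(\mathbf a)\in\mathcal C_{\mathbf A}$ and all $f:\{\mathbf a\}\to B$ with $f(\mathbf a)\notin R(\mathbf B)$. It is feasible if it has a real solution. **Iterated degrees.** For $a\in A$ and $R(\mathbf a)\in\mathcal C_{\mathbf A}$ put $M_{\mathbf A}[a,R(\mathbf a)]=(S,R)$ with $S=\{i : \mathbf a[i]=a\}$ (possibly empty). Let $\delta_0^{\mathbf A}$ take one fixed value on all elements of $A$ and another one on all constraints, and for $n\ge1$ define the multisets $$\delta_n^{\mathbf A}(a)=\{\{(M_{\mathbf A}[a,c],\delta_{n-1}^{\mathbf A}(c)) : c\in\mathcal C_{\mathbf A}\}\},\qquad \delta_n^{\mathbf A}(c)=\{\{(M_{\mathbf A}[a,c],\delta_{n-1}^{\mathbf A}(a)) : a\in A\}\}$$ for $a\in A$ and $c\in\mathcal C_{\mathbf A}$ respectively. Structures $\mathbf A,\mathbf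 A'$ over the same signature have the same iterated degree sequence if for every $n\ge0$ the multisets $\{\{\delta_n^{\mathbf A}(x) : x\in A\cup\mathcal C_{\mathbf A}\}\}$ and $\{\{\delta_n^{\mathbf A'}(x) : x\in A'\cup\mathcal C_{\mathbf A'}\}\}$ are equal. **The relation $\equiv_{\mathrm{WL}\,k}$.** For a $\sigma$-structure $\mathbf A$ let $\mathbf A^{*_k}$ be the structure with universe the disjoint union of $A^1,\dots,A^k$ and $\mathcal C_{\mathbf A}$ and with the relations - $T_{j,S}=\{\mathbf a\in A^j : a_i=a_{i'}\ \forall i,i'\in S\}$ (unary) for $1\le j\le k$, $S\subseteq[j]$; - $T_{j,\mathbf i}=\{(\mathbf a,\pi_{\mathbf i}\mathbf a) : \mathbf a\in A^j\}$ (binary) for $1\le j,j'\le k$, $\mathbf i\in[j]^{j'}$; - $R_S=\{R(\mathbf a) : \mathbf a\in R(\mathbf A),\ a_i=a_{i'}\ \forall i,i'\in S\}$ (unary) for $R\in\sigma$, $S\subseteq[\mathrm{arity}(R)]$; - $R_{\mathbf i}=\{(R(\mathbf a),\pi_{\mathbf i}\mathbf a) : \mathbf a\in R(\mathbf A)\}$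 (binary) for $R\in\sigma$, $1\le j\le k$, $\mathbf i\in[\mathrm{arity}(R)]^{j}$, where $\pi_{\mathbf i}\mathbf a=(a_{i_1},a_{i_2},\dots)$. Write $\mathbf A\equiv_{\mathrm{WL}\,k}\mathbf A'$ if $\mathbf A^{*_k}$ and $\mathbf A'^{*_k}$ have the same iterated degree sequence. **Statement.** Let $k\ge1$ and let $\mathbf A,\mathbf A'$ be $\sigma$-structures with $\mathbf A\equiv_{\mathrm{WL}\,k}\mathbf A'$. Then for every $\sigma$-structure $\mathbf B$, $\mathrm{SA}^k(\mathbf A,\mathbf B)$ is feasible if and only if $\mathrm{SA}^k(\mathbf A',\mathbf B)$ is feasible. -/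

import Mathlib

/-! # Relational structures, the Sherali-Adams relaxation, and Weisfeiler-Leman equivalence -/

universe u v w

/-- A relational signature: finitely many relation symbols, each with a positive arity. -/
structure RelSignature where
  Symbol : Type u
  arity : Symbol → ℕ
  arity_pos : ∀ R, 0 < arity R
  finite_symbol : Finite Symbol

attribute [instance] RelSignature.finite_symbol

/-- A `σ`-structure with universe `A`. -/
structure RelStructure (σ : RelSignature.{u}) (A : Type v) where
  rel : (R : σ.Symbol) → Set (Fin (σ.arity R) → A)

namespace RelStructure

variable {σ : RelSignature.{u}} {A : Type v} {B : Type w}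

/-- The constraints `R(a)` of a structure: a relation symbol `R` and a tuple `a ∈ R(𝐀)`. -/
structure Constraint (X : RelStructure σ A) where
  symbol : σ.Symbol
  tuple : Fin (σ.arity symbol) → A
  mem : tuple ∈ X.rel symbol

instance (X : RelStructure σ A) [Finite A] : Finite X.Constraint :=
  Finite.of_injective
    (fun c => (⟨c.symbol, c.tuple⟩ : (R : σ.Symbol) × (Fin (σ.arity R) → A)))
    (by rintro ⟨R, a, h⟩ ⟨R', a', h'⟩ heq; cases heq; rfl)

noncomputable instance (X : RelStructure σ A) [Finite A] : Fintype X.Constraint :=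
  Fintype.ofFinite _

/-! ### The Sherali-Adams system -/

open Classical in
/-- The set `{a}` of elements that occur in the tuple of a constraint `R(a)`. -/
noncomputable def Constraint.support {X : RelStructure σ A} (c : X.Constraint) : Finset A :=
  Finset.univ.image c.tuple

theorem Constraint.tuple_mem_support {X : RelStructure σ A} (c : X.Constraint)
    (i : Fin (σ.arity c.symbol)) : c.tuple i ∈ c.support := by
  classical
  exact Finset.mem_image_of_mem _ (Finset.mem_univ i)

open Classical in
/-- `(p, q)` satisfies the level-`k` system for the homomorphism problem over `(X, Y)`.
The variables are `p V f` for `V ⊆ A` with `1 ≤ |V| ≤ k` and `f : V → B`, and `q c f` for a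
constraint `c = R(a)` of `X` and `f : {a} → B`; the values `p V f` for other sets `V` are not
variables of the system and no condition mentions them. -/
structure IsSASolution [Fintype B] (k : ℕ) (X : RelStructure σ A) (Y : RelStructure σ B)
    (p : (V : Finset A) → (V → B) → ℝ)
    (q : (c : X.Constraint) → (c.support → B) → ℝ) : Prop where
  p_mem_Icc : ∀ V : Finset A, V.Nonempty → V.card ≤ k → ∀ f : V → B, p V f ∈ Set.Icc (0 : ℝ) 1
  q_mem_Icc : ∀ (c : X.Constraint) (f : c.support → B), q c f ∈ Set.Icc (0 : ℝ) 1
  sum_eq_one : ∀ V : Finset A, V.Nonempty → V.card ≤ k → ∑ f : V → B, p V f = 1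
  marginal : ∀ (U V : Finset A) (hUV : U ⊆ V), U.Nonempty → V.card ≤ k → ∀ f : U → B,
    p U f = ∑ g : V → B with Finset.restrict₂ (π := fun _ => B) hUV g = f, p V g
  marginal_constraint : ∀ (c : X.Constraint) (U : Finset A) (hU : U ⊆ c.support),
    U.Nonempty → U.card ≤ k → ∀ f : U → B,
    p U f = ∑ g : c.support → B with Finset.restrict₂ (π := fun _ => B) hU g = f, q c g
  forbidden : ∀ (c : X.Constraint) (f : c.support → B),
    (fun i => f ⟨c.tuple i, c.tuple_mem_support i⟩) ∉ Y.rel c.symbol → q c f = 0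

/-- Feasibility of the level-`k` Sherali-Adams relaxation `SA^k(X, Y)`. -/
def SAFeasible [Fintype B] (k : ℕ) (X : RelStructure σ A) (Y : RelStructure σ B) : Prop :=
  ∃ (p : (V : Finset A) → (V → B) → ℝ) (q : (c : X.Constraint) → (c.support → B) → ℝ),
    IsSASolution k X Y p q

end RelStructure

/-! ### Iterated degrees -/

/-- Labels `(S, R)` with `R` a relation symbol and `S` a set of argument positions of `R`. -/
abbrev RelSignature.Label (σ : RelSignature.{u}) : Type u :=
  (R : σ.Symbol) × Finset (Fin (σ.arity R))

/-- Two symbols, that mark elements and constraints. -/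
inductive NodeKind : Type u
  | element
  | constraint

/-- The values that iterated degrees of depth `n` take. -/
def RelSignature.IterDegree (σ : RelSignature.{u}) : ℕ → Type u
  | 0 => NodeKind
  | n + 1 => Multiset (σ.Label × RelSignature.IterDegree σ n)

namespace RelStructure

variable {σ : RelSignature.{u}} {A : Type v} {B : Type w}

open Classical in
/-- The entry `M_X[a, R(t)] = (S, R)` of the matrix representation, where `S` is the set of the
positions at which `a` occurs in `t`. It is defined for all `a` and `R(t)`; `S` may be empty. -/
noncomputable def matrixEntry (X : RelStructure σ A) (a : A) (c : X.Constraint) : σ.Label :=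
  ⟨c.symbol, Finset.univ.filter fun i => c.tuple i = a⟩

/-- The iterated degree of depth `n` of an element or a constraint. -/
noncomputable def iterDegree [Fintype A] (X : RelStructure σ A) :
    (n : ℕ) → A ⊕ X.Constraint → σ.IterDegree n
  | 0, .inl _ => NodeKind.element
  | 0, .inr _ => NodeKind.constraint
  | n + 1, .inl a => ((Finset.univ : Finset X.Constraint).val.map fun c =>
      (X.matrixEntry a c, iterDegree X n (.inr c)) : Multiset (σ.Label × σ.IterDegree n))
  | n + 1, .inr c => ((Finset.univ : Finset A).val.map fun a =>
      (X.matrixEntry a c, iterDegree X n (.inl a)) : Multiset (σ.Label × σ.IterDegree n))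

/-- `X` and `Y` have the same iterated degree sequence: colour refinement on elements and
constraints (the one-dimensional Weisfeiler-Leman test) does not distinguish them. -/
def SameIterDegreeSequence [Fintype A] [Fintype B]
    (X : RelStructure σ A) (Y : RelStructure σ B) : Prop :=
  ∀ n : ℕ,
    (Finset.univ : Finset (A ⊕ X.Constraint)).val.map (X.iterDegree n) =
      (Finset.univ : Finset (B ⊕ Y.Constraint)).val.map (Y.iterDegree n)

end RelStructure

/-! ### The transformation `*_k` -/

/-- The symbols of the signature of `X^{*_k}`. An index `j : Fin k` stands for the length `j + 1`,
so that the lengths range over `1, …, k`. The four families are `T_{j,S}`, `T_{j,i}`, `R_S` and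
`R_i`, in this order. -/
inductive RelSignature.StarSymbol (σ : RelSignature.{u}) (k : ℕ) : Type u
  | tupleEq (j : Fin k) (S : Finset (Fin (j.val + 1)))
  | tupleProj (j j' : Fin k) (i : Fin (j'.val + 1) → Fin (j.val + 1))
  | constraintEq (R : σ.Symbol) (S : Finset (Fin (σ.arity R)))
  | constraintProj (R : σ.Symbol) (j : Fin k) (i : Fin (j.val + 1) → Fin (σ.arity R))

instance (σ : RelSignature.{u}) (k : ℕ) : Finite (σ.StarSymbol k) := by
  let T := ((j : Fin k) × Finset (Fin (j.val + 1))) ⊕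
    ((j : Fin k) × (j' : Fin k) × (Fin (j'.val + 1) → Fin (j.val + 1))) ⊕
    ((R : σ.Symbol) × Finset (Fin (σ.arity R))) ⊕
    ((R : σ.Symbol) × (j : Fin k) × (Fin (j.val + 1) → Fin (σ.arity R)))
  let f : T → σ.StarSymbol k := fun t => match t with
    | .inl ⟨j, S⟩ => .tupleEq j S
    | .inr (.inl ⟨j, j', i⟩) => .tupleProj j j' i
    | .inr (.inr (.inl ⟨R, S⟩)) => .constraintEq R S
    | .inr (.inr (.inr ⟨R, j, i⟩)) => .constraintProj R j i
  refine Finite.of_surjective f fun s => ?_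
  cases s with
  | tupleEq j S => exact ⟨.inl ⟨j, S⟩, rfl⟩
  | tupleProj j j' i => exact ⟨.inr (.inl ⟨j, j', i⟩), rfl⟩
  | constraintEq R S => exact ⟨.inr (.inr (.inl ⟨R, S⟩)), rfl⟩
  | constraintProj R j i => exact ⟨.inr (.inr (.inr ⟨R, j, i⟩)), rfl⟩

/-- The arities in the signature of `X^{*_k}`: one for `T_{j,S}`, `R_S`, two for `T_{j,i}`, `R_i`. -/
def RelSignature.starArity (σ : RelSignature.{u}) (k : ℕ) : σ.StarSymbol k → ℕ
  | .tupleEq _ _ => 1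
  | .tupleProj _ _ _ => 2
  | .constraintEq _ _ => 1
  | .constraintProj _ _ _ => 2

/-- The signature of `X^{*_k}`. -/
def RelSignature.star (σ : RelSignature.{u}) (k : ℕ) : RelSignature.{u} where
  Symbol := σ.StarSymbol k
  arity := σ.starArity k
  arity_pos := by rintro (_ | _ | _ | _) <;> simp [RelSignature.starArity]
  finite_symbol := inferInstance

namespace RelStructure

variable {σ : RelSignature.{u}} {A : Type v} {B : Type w}

/-- The universe of `X^{*_k}`: the tuples over `A` of length `1, …, k`, and the constraints of
`X`. -/
abbrev StarUniverse (X : RelStructure σ A) (k : ℕ) : Type max u v :=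
  ((j : Fin k) × (Fin (j.val + 1) → A)) ⊕ X.Constraint

/-- The relations of `X^{*_k}`. -/
def starRel (X : RelStructure σ A) (k : ℕ) :
    (s : σ.StarSymbol k) → Set (Fin (σ.starArity k s) → X.StarUniverse k)
  | .tupleEq j S =>
      {x : Fin 1 → X.StarUniverse k | ∃ a : Fin (j.val + 1) → A,
        (∀ m ∈ S, ∀ m' ∈ S, a m = a m') ∧ x = ![Sum.inl ⟨j, a⟩]}
  | .tupleProj j j' i =>
      {x : Fin 2 → X.StarUniverse k | ∃ a : Fin (j.val + 1) → A,
        x = ![Sum.inl ⟨j, a⟩, Sum.inl ⟨j', a ∘ i⟩]}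
  | .constraintEq R S =>
      {x : Fin 1 → X.StarUniverse k | ∃ (a : Fin (σ.arity R) → A) (ha : a ∈ X.rel R),
        (∀ m ∈ S, ∀ m' ∈ S, a m = a m') ∧ x = ![Sum.inr ⟨R, a, ha⟩]}
  | .constraintProj R j i =>
      {x : Fin 2 → X.StarUniverse k | ∃ (a : Fin (σ.arity R) → A) (ha : a ∈ X.rel R),
        x = ![Sum.inr ⟨R, a, ha⟩, Sum.inl ⟨j, a ∘ i⟩]}

/-- The structure `X^{*_k}`. -/
def star (X : RelStructure σ A) (k : ℕ) : RelStructure (σ.star k) (X.StarUniverse k) where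
  rel := X.starRel k

open Classical in
/-- `X ≡_{WL k} Y`: the structures `X^{*_k}` and `Y^{*_k}` have the same iterated degree
sequence. -/
def EqWL [Fintype A] [Fintype B] (k : ℕ) (X : RelStructure σ A) (Y : RelStructure σ B) : Prop :=
  SameIterDegreeSequence (X.star k) (Y.star k)

end RelStructure

/-! A solution is averaged over the stable colour classes of `X^{*_k}` and copied to `X'`. Sets and
partial maps are first replaced by tuples and words: a solution becomes a weight `M x l` of words
`l` at the nodes `x` of `X^{*_k}` (`IsStarMass`). Words are lists, so weights at nodes of different
lengths and arities have one type and can be averaged. A node of `X'^{*_k}` receives the mean of `M`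
over the nodes of `X^{*_k}` with the same iterated degrees (`IsStarMass.classMean`), and the result
is read back as a solution (`IsStarMass.saFeasible`).

The bounds and normalisations survive any averaging, and the support conditions survive because the
unary relations of `X^{*_k}` make length, symbol and repeated entries invariants of the colour. A
marginal equation links the two entries of a pair in a binary relation. The stable colouring is
equitable, so by double counting (`exists_sum_entries_eq`) an identity between two positions of all
tuples of a relation survives averaging over the two classes (`classMean_eq_of_mem_rel`). The
equality of degree sequences serves to make all these classes nonempty. -/

theorem Multiset.exists_equiv_of_map_univ_eq {α β γ : Type*} [Fintype α] [Fintype β]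
    {f : α → γ} {g : β → γ}
    (h : (Finset.univ : Finset α).val.map f = (Finset.univ : Finset β).val.map g) :
    ∃ e : α ≃ β, ∀ a, g (e a) = f a := by
  classical
  have key : ∀ d, Nonempty ({a // f a = d} ≃ {b // g b = d}) := by
    intro d
    have h1 := congrArg (Multiset.count d) h
    rw [Multiset.count_map, Multiset.count_map] at h1
    refine ⟨Fintype.equivOfCardEq ?_⟩
    rw [Fintype.card_subtype, Fintype.card_subtype, Finset.card_def, Finset.card_def]
    simpa only [Finset.filter_val, eq_comm] using h1
  exact ⟨Equiv.ofFiberEquiv fun d => (key d).some, fun a => Equiv.ofFiberEquiv_map _ a⟩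

/-! ### Iterated degrees and the stable colouring -/

/-- The kind other than the given one. -/
def NodeKind.swap : NodeKind.{u} → NodeKind.{u}
  | .element => .constraint
  | .constraint => .element

/-- The iterated degree of depth `n` of a node of the given kind, read off from the one of depth
`n + 1`. -/
def RelSignature.truncateDegree (σ : RelSignature.{u}) :
    NodeKind.{u} → (n : ℕ) → σ.IterDegree (n + 1) → σ.IterDegree n
  -- An empty multiset does not reveal the kind of its node, so the kind is carried along; it
  -- alternates with the depth.
  | κ, 0, _ => κ
  | κ, n + 1, m => Multiset.map
      (fun x : σ.Label × σ.IterDegree (n + 1) =>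
        (x.1, RelSignature.truncateDegree σ κ.swap n x.2)) m

namespace RelStructure

variable {σ : RelSignature.{u}} {A : Type v} {B : Type w}

theorem truncateDegree_iterDegree [Fintype A] (X : RelStructure σ A) (n : ℕ) :
    (∀ a, σ.truncateDegree .element n (X.iterDegree (n + 1) (.inl a)) = X.iterDegree n (.inl a)) ∧
    (∀ c, σ.truncateDegree .constraint n (X.iterDegree (n + 1) (.inr c)) =
      X.iterDegree n (.inr c)) := by
  induction n with
  | zero => exact ⟨fun _ => rfl, fun _ => rfl⟩
  | succ n ih =>
    constructor
    · intro a
      refine (Multiset.map_map _ _ _).trans (Multiset.map_congr rfl fun c _ => ?_)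
      exact congrArg (Prod.mk _) (ih.2 c)
    · intro c
      refine (Multiset.map_map _ _ _).trans (Multiset.map_congr rfl fun a _ => ?_)
      exact congrArg (Prod.mk _) (ih.1 a)

section Equivalence

variable [Fintype A] [Fintype B]

theorem exists_constraint_equiv {X : RelStructure σ A} {Y : RelStructure σ B} {n : ℕ} {a : A}
    {b : B} (h : X.iterDegree (n + 1) (.inl a) = Y.iterDegree (n + 1) (.inl b)) :
    ∃ e : X.Constraint ≃ Y.Constraint, ∀ c, Y.matrixEntry b (e c) = X.matrixEntry a c ∧
      Y.iterDegree n (.inr (e c)) = X.iterDegree n (.inr c) := by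
  obtain ⟨e, he⟩ := Multiset.exists_equiv_of_map_univ_eq h
  exact ⟨e, fun c => ⟨congrArg Prod.fst (he c), congrArg Prod.snd (he c)⟩⟩

theorem exists_element_equiv {X : RelStructure σ A} {Y : RelStructure σ B} {n : ℕ}
    {c : X.Constraint} {d : Y.Constraint}
    (h : X.iterDegree (n + 1) (.inr c) = Y.iterDegree (n + 1) (.inr d)) :
    ∃ e : A ≃ B, ∀ a, Y.matrixEntry (e a) d = X.matrixEntry a c ∧
      Y.iterDegree n (.inl (e a)) = X.iterDegree n (.inl a) := by
  obtain ⟨e, he⟩ := Multiset.exists_equiv_of_map_univ_eq h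
  exact ⟨e, fun a => ⟨congrArg Prod.fst (he a), congrArg Prod.snd (he a)⟩⟩

/-- Arities are positive, so `d` has an entry and its multiset contains the degree of an element,
whereas that of `a` contains degrees of constraints only. The roles of the structures swap at each
depth, hence the two-sided induction in `iterDegree_inl_ne_inr`. -/
theorem iterDegree_inl_ne_inr_succ {X : RelStructure σ A} {Y : RelStructure σ B} {n : ℕ}
    (ih : ∀ b c, Y.iterDegree n (.inl b) ≠ X.iterDegree n (.inr c)) (a : A) (d : Y.Constraint) :
    X.iterDegree (n + 1) (.inl a) ≠ Y.iterDegree (n + 1) (.inr d) := by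
  intro h
  let b := d.tuple ⟨0, σ.arity_pos _⟩
  have hb : (Y.matrixEntry b d, Y.iterDegree n (.inl b)) ∈
      ((Finset.univ : Finset B).val.map fun b =>
        (Y.matrixEntry b d, Y.iterDegree n (.inl b))) :=
    Multiset.mem_map_of_mem _ (Finset.mem_univ_val b)
  have h' : ((Finset.univ : Finset X.Constraint).val.map fun c =>
        (X.matrixEntry a c, X.iterDegree n (.inr c))) =
      ((Finset.univ : Finset B).val.map fun b =>
        (Y.matrixEntry b d, Y.iterDegree n (.inl b))) := h
  rw [← h'] at hb
  obtain ⟨c, -, hc⟩ := Multiset.mem_map.1 hb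
  exact ih b c (congrArg Prod.snd hc).symm

theorem iterDegree_inl_ne_inr (X : RelStructure σ A) (Y : RelStructure σ B) (n : ℕ) :
    (∀ a d, X.iterDegree n (.inl a) ≠ Y.iterDegree n (.inr d)) ∧
      ∀ b c, Y.iterDegree n (.inl b) ≠ X.iterDegree n (.inr c) := by
  induction n with
  | zero => exact ⟨fun _ _ h => (by cases h), fun _ _ h => (by cases h)⟩
  | succ n ih => exact ⟨iterDegree_inl_ne_inr_succ ih.2, iterDegree_inl_ne_inr_succ ih.1⟩

/-- The elements `a` of `X` and `b` of `Y` have the same iterated degrees of all depths. -/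
def ElementEquiv (X : RelStructure σ A) (Y : RelStructure σ B) (a : A) (b : B) : Prop :=
  ∀ n, X.iterDegree n (.inl a) = Y.iterDegree n (.inl b)

/-- The constraints `c` of `X` and `d` of `Y` have the same iterated degrees of all depths. -/
def ConstraintEquiv (X : RelStructure σ A) (Y : RelStructure σ B) (c : X.Constraint)
    (d : Y.Constraint) : Prop :=
  ∀ n, X.iterDegree n (.inr c) = Y.iterDegree n (.inr d)

theorem iterDegree_inl_eq_of_le {X : RelStructure σ A} {Y : RelStructure σ B} {a : A} {b : B}
    {m n : ℕ} (hmn : m ≤ n) (h : X.iterDegree n (.inl a) = Y.iterDegree n (.inl b)) :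
    X.iterDegree m (.inl a) = Y.iterDegree m (.inl b) := by
  induction n, hmn using Nat.le_induction with
  | base => exact h
  | succ n _ ih =>
    apply ih
    rw [← (X.truncateDegree_iterDegree n).1, ← (Y.truncateDegree_iterDegree n).1, h]

theorem iterDegree_inr_eq_of_le {X : RelStructure σ A} {Y : RelStructure σ B} {c : X.Constraint}
    {d : Y.Constraint} {m n : ℕ} (hmn : m ≤ n)
    (h : X.iterDegree n (.inr c) = Y.iterDegree n (.inr d)) :
    X.iterDegree m (.inr c) = Y.iterDegree m (.inr d) := by
  induction n, hmn using Nat.le_induction with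
  | base => exact h
  | succ n _ ih =>
    apply ih
    rw [← (X.truncateDegree_iterDegree n).2, ← (Y.truncateDegree_iterDegree n).2, h]

end Equivalence

/-- Finitely many decreasing sequences of propositions are simultaneously stable from some index
on. -/
theorem exists_forall_of_antitone {ι : Type*} [Finite ι] (P : ι → ℕ → Prop)
    (hP : ∀ i m n, m ≤ n → P i n → P i m) : ∃ N, ∀ i, P i N → ∀ n, P i n := by
  classical
  have h1 : ∀ i, ∃ N, P i N → ∀ n, P i n := by
    intro i
    by_cases h : ∀ n, P i n
    · exact ⟨0, fun _ => h⟩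
    · push Not at h
      obtain ⟨N, hN⟩ := h
      exact ⟨N, fun h => absurd h hN⟩
  choose N hN using h1
  obtain ⟨M, hM⟩ := (Set.finite_range N).bddAbove
  exact ⟨M, fun i hi => hN i (hP i _ _ (hM ⟨i, rfl⟩) hi)⟩

section Stable

variable [Fintype A] [Fintype B]

/-- There are finitely many pairs to compare, and equality at one depth implies equality at all
smaller depths. -/
theorem exists_stable_depth (X : RelStructure σ A) (Y : RelStructure σ B) :
    ∃ N, (∀ a b, X.iterDegree N (.inl a) = Y.iterDegree N (.inl b) → ElementEquiv X Y a b) ∧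
      ∀ c d, X.iterDegree N (.inr c) = Y.iterDegree N (.inr d) → ConstraintEquiv X Y c d := by
  obtain ⟨N, hN⟩ := exists_forall_of_antitone
    (fun (i : A × B) n => X.iterDegree n (.inl i.1) = Y.iterDegree n (.inl i.2))
    fun _ _ _ h => iterDegree_inl_eq_of_le h
  obtain ⟨M, hM⟩ := exists_forall_of_antitone
    (fun (i : X.Constraint × Y.Constraint) n =>
      X.iterDegree n (.inr i.1) = Y.iterDegree n (.inr i.2))
    fun _ _ _ h => iterDegree_inr_eq_of_le h
  exact ⟨max N M,
    fun a b h => hN (a, b) (iterDegree_inl_eq_of_le (le_max_left _ _) h),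
    fun c d h => hM (c, d) (iterDegree_inr_eq_of_le (le_max_right _ _) h)⟩

variable {X : RelStructure σ A} {Y : RelStructure σ B}

/-- Equality at depth `N + 1` gives a bijection that respects depth `N`, which already decides all
depths. This is the equitability of the stable colouring. -/
theorem ElementEquiv.exists_constraint_equiv {a : A} {b : B} (h : ElementEquiv X Y a b) :
    ∃ e : X.Constraint ≃ Y.Constraint, ∀ c, Y.matrixEntry b (e c) = X.matrixEntry a c ∧
      ConstraintEquiv X Y c (e c) := by
  obtain ⟨N, -, hN⟩ := exists_stable_depth X Y
  obtain ⟨e, he⟩ := RelStructure.exists_constraint_equiv (h (N + 1))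
  exact ⟨e, fun c => ⟨(he c).1, hN _ _ (he c).2.symm⟩⟩

theorem ConstraintEquiv.exists_element_equiv {c : X.Constraint} {d : Y.Constraint}
    (h : ConstraintEquiv X Y c d) :
    ∃ e : A ≃ B, ∀ a, Y.matrixEntry (e a) d = X.matrixEntry a c ∧ ElementEquiv X Y a (e a) := by
  obtain ⟨N, hN, -⟩ := exists_stable_depth X Y
  obtain ⟨e, he⟩ := RelStructure.exists_element_equiv (h (N + 1))
  exact ⟨e, fun a => ⟨(he a).1, hN _ _ (he a).2.symm⟩⟩

theorem SameIterDegreeSequence.exists_elementEquiv (h : SameIterDegreeSequence X Y) (b : B) :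
    ∃ a, ElementEquiv X Y a b := by
  obtain ⟨N, hN, -⟩ := exists_stable_depth X Y
  obtain ⟨e, he⟩ := Multiset.exists_equiv_of_map_univ_eq (h N)
  obtain ⟨x, hx⟩ := e.surjective (.inl b)
  have hx' := he x
  rw [hx] at hx'
  cases x with
  | inl a => exact ⟨a, hN _ _ hx'.symm⟩
  | inr c => exact absurd hx' ((iterDegree_inl_ne_inr X Y N).2 b c)

end Stable

end RelStructure

/-! ### Means over colour classes -/

namespace RelStructure

variable {σ : RelSignature.{u}} {A : Type v} {B : Type w}

/-- The constraint `c` has symbol `R` and the entry `a` at position `i`. -/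
def HasEntry (X : RelStructure σ A) (c : X.Constraint) (R : σ.Symbol) (i : Fin (σ.arity R))
    (a : A) : Prop :=
  ∃ S, i ∈ S ∧ X.matrixEntry a c = ⟨R, S⟩

theorem hasEntry_mk {X : RelStructure σ A} {R : σ.Symbol} {t : Fin (σ.arity R) → A}
    (h : t ∈ X.rel R) {i : Fin (σ.arity R)} {a : A} :
    X.HasEntry ⟨R, t, h⟩ R i a ↔ t i = a := by
  classical
  constructor
  · rintro ⟨S, hi, hS⟩
    have hS' := eq_of_heq (Sigma.mk.inj hS).2
    rw [← hS'] at hi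
    simpa using hi
  · intro ht
    exact ⟨_, by simpa using ht, rfl⟩

theorem HasEntry.exists_eq_mk {X : RelStructure σ A} {c : X.Constraint} {R : σ.Symbol}
    {i : Fin (σ.arity R)} {a : A} (h : X.HasEntry c R i a) :
    ∃ (t : Fin (σ.arity R) → A) (ht : t ∈ X.rel R), c = ⟨R, t, ht⟩ := by
  obtain ⟨R', t, ht⟩ := c
  obtain ⟨S, hi, hS⟩ := h
  obtain rfl : R' = R := congrArg Sigma.fst hS
  exact ⟨t, ht, rfl⟩

theorem HasEntry.eq {X : RelStructure σ A} {c : X.Constraint} {R : σ.Symbol}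
    {i : Fin (σ.arity R)} {a b : A} (h : X.HasEntry c R i a) (h' : X.HasEntry c R i b) :
    a = b := by
  obtain ⟨t, ht, rfl⟩ := h.exists_eq_mk
  exact ((hasEntry_mk ht).1 h).symm.trans ((hasEntry_mk ht).1 h')

/-- Since `HasEntry` depends on the matrix entry alone, it passes between structures without casts
along equalities of symbols. -/
theorem hasEntry_congr {X : RelStructure σ A} {Y : RelStructure σ B} {c : X.Constraint}
    {d : Y.Constraint} {a : A} {b : B} (h : Y.matrixEntry b d = X.matrixEntry a c) (R : σ.Symbol)
    (i : Fin (σ.arity R)) : Y.HasEntry d R i b ↔ X.HasEntry c R i a := by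
  rw [HasEntry, HasEntry, h]

variable [Fintype A] [Fintype B]

theorem ElementEquiv.symm {X : RelStructure σ A} {Y : RelStructure σ B} {a : A} {b : B}
    (h : ElementEquiv X Y a b) : ElementEquiv Y X b a := fun n => (h n).symm

/-- Colour-equivalent elements lie at the same positions of tuples of the same relations. -/
theorem ElementEquiv.exists_mem_rel {X : RelStructure σ A} {Y : RelStructure σ B} {a : A} {b : B}
    (h : ElementEquiv X Y a b) {R : σ.Symbol} {t : Fin (σ.arity R) → A} (ht : t ∈ X.rel R)
    {i : Fin (σ.arity R)} (hi : t i = a) : ∃ s ∈ Y.rel R, s i = b := by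
  obtain ⟨e, he⟩ := h.exists_constraint_equiv
  have h1 := (hasEntry_congr (he ⟨R, t, ht⟩).1 R i).2 ((hasEntry_mk ht).2 hi)
  obtain ⟨s, hs, hc⟩ := h1.exists_eq_mk
  rw [hc, hasEntry_mk] at h1
  exact ⟨s, hs, h1⟩

open Classical in
/-- The mean of `G` over the elements of `X` that are colour-equivalent to `b`. -/
noncomputable def classMean (X : RelStructure σ A) (Y : RelStructure σ B) (b : B) (G : A → ℝ) :
    ℝ :=
  (∑ a with ElementEquiv X Y a b, G a) / ∑ a with ElementEquiv X Y a b, (1 : ℝ)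

open Classical in
-- Double counting of pairs `(c, a)` with `c` in the class of `d` and `a` at position `i` of `c`.
-- Such an `a` lies in the class of `b`, and each member of that class occurs equally often, namely
-- as often as `b` does in `Y`. This number is nonzero because `d` itself is counted.
theorem exists_sum_entries_eq (X : RelStructure σ A) (Y : RelStructure σ B) {d : Y.Constraint}
    {R : σ.Symbol} {i : Fin (σ.arity R)} {b : B} (hd : Y.HasEntry d R i b) :
    ∃ N : ℝ, N ≠ 0 ∧ ∀ G : A → ℝ,
      ∑ c with ConstraintEquiv X Y c d, ∑ a with X.HasEntry c R i a, G a =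
        N * ∑ a with ElementEquiv X Y a b, G a := by
  refine ⟨((Finset.univ.filter fun d' : Y.Constraint =>
    ConstraintEquiv Y Y d' d ∧ Y.HasEntry d' R i b).card : ℝ), ?_, fun G => ?_⟩
  · rw [Nat.cast_ne_zero]
    exact Finset.card_ne_zero_of_mem
      (Finset.mem_filter.2 ⟨Finset.mem_univ d, fun _ => rfl, hd⟩)
  have hcard : ∀ a, (((Finset.univ.filter fun c : X.Constraint =>
      ConstraintEquiv X Y c d ∧ X.HasEntry c R i a).card : ℕ) : ℝ) * G a =
      if ElementEquiv X Y a b then ((Finset.univ.filter fun d' : Y.Constraint =>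
        ConstraintEquiv Y Y d' d ∧ Y.HasEntry d' R i b).card : ℝ) * G a else 0 := by
    intro a
    split_ifs with ha
    · obtain ⟨e, he⟩ := ha.exists_constraint_equiv
      congr 2
      refine Finset.card_equiv e fun c => ?_
      simp only [Finset.mem_filter, Finset.mem_univ, true_and]
      refine and_congr ⟨fun h n => ?_, fun h n => ?_⟩ (hasEntry_congr (he c).1 R i).symm
      · rw [← (he c).2 n, h n]
      · rw [(he c).2 n, h n]
    · rw [Finset.card_eq_zero.2, Nat.cast_zero, zero_mul]
      refine Finset.filter_eq_empty_iff.2 fun c _ hc => ha ?_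
      obtain ⟨e, he⟩ := hc.1.exists_element_equiv
      have h1 := (hasEntry_congr (he a).1 R i).2 hc.2
      -- Both `b` and `e a` are the entry of `d` at position `i`.
      rw [hd.eq h1]
      exact (he a).2
  calc ∑ c with ConstraintEquiv X Y c d, ∑ a with X.HasEntry c R i a, G a
      = ∑ c : X.Constraint, ∑ a : A,
          if ConstraintEquiv X Y c d ∧ X.HasEntry c R i a then G a else 0 := by
        rw [Finset.sum_filter]
        refine Finset.sum_congr rfl fun c _ => ?_
        split_ifs with h
        · simp [h, Finset.sum_filter]
        · simp [h]
    _ = ∑ a : A, (((Finset.univ.filter fun c : X.Constraint =>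
          ConstraintEquiv X Y c d ∧ X.HasEntry c R i a).card : ℕ) : ℝ) * G a := by
        rw [Finset.sum_comm]
        refine Finset.sum_congr rfl fun a _ => ?_
        rw [← Finset.sum_filter, Finset.sum_const, nsmul_eq_mul]
    _ = _ := by
        rw [Finset.sum_congr rfl fun a _ => hcard a, ← Finset.sum_filter, Finset.mul_sum]

/-- Means over colour classes agree at the two positions of a constraint. -/
theorem classMean_eq_of_mem_rel (X : RelStructure σ A) (Y : RelStructure σ B) {R : σ.Symbol}
    {s : Fin (σ.arity R) → B} (hs : s ∈ Y.rel R) (i j : Fin (σ.arity R)) {G H : A → ℝ}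
    (hGH : ∀ t ∈ X.rel R, G (t i) = H (t j)) :
    classMean X Y (s i) G = classMean X Y (s j) H := by
  classical
  -- A constraint in the class of `⟨R, s, hs⟩` has symbol `R`, hence a single entry at each
  -- position, and the inner sums collapse to `G (t i)` and `H (t j)`.
  have key : ∀ G H : A → ℝ, (∀ t ∈ X.rel R, G (t i) = H (t j)) →
      ∑ c with ConstraintEquiv X Y c ⟨R, s, hs⟩, ∑ a with X.HasEntry c R i a, G a =
      ∑ c with ConstraintEquiv X Y c ⟨R, s, hs⟩, ∑ a with X.HasEntry c R j a, H a := by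
    intro G H hGH
    refine Finset.sum_congr rfl fun c hc => ?_
    obtain ⟨e, he⟩ := (Finset.mem_filter.1 hc).2.exists_element_equiv
    have h1 := hasEntry_congr (he (e.symm (s i))).1 R i
    rw [e.apply_symm_apply, hasEntry_mk] at h1
    obtain ⟨t, ht, rfl⟩ := (h1.1 rfl).exists_eq_mk
    simp only [hasEntry_mk, Finset.sum_filter, Finset.sum_ite_eq, Finset.mem_univ, if_true]
    exact hGH t ht
  obtain ⟨N, hN, hNG⟩ := exists_sum_entries_eq X Y (d := ⟨R, s, hs⟩) ((hasEntry_mk hs).2 rfl :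
    Y.HasEntry _ R i (s i))
  obtain ⟨M, hM, hMG⟩ := exists_sum_entries_eq X Y (d := ⟨R, s, hs⟩) ((hasEntry_mk hs).2 rfl :
    Y.HasEntry _ R j (s j))
  have h1 := key G H hGH
  -- The constant `1` yields the same relation between the denominators.
  have h2 := key (fun _ => 1) (fun _ => 1) fun _ _ => rfl
  rw [hNG, hMG] at h1 h2
  rw [classMean, classMean, ← mul_div_mul_left _ _ hN, h1, h2, mul_div_mul_left _ _ hM]

theorem classMean_sum (X : RelStructure σ A) (Y : RelStructure σ B) (b : B) {ι : Type*}
    (I : Finset ι) (G : ι → A → ℝ) :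
    classMean X Y b (fun a => ∑ l ∈ I, G l a) = ∑ l ∈ I, classMean X Y b (G l) := by
  simp only [classMean, ← Finset.sum_div]
  rw [Finset.sum_comm]

theorem classMean_congr {X : RelStructure σ A} {Y : RelStructure σ B} {b : B} {G H : A → ℝ}
    (h : ∀ a, ElementEquiv X Y a b → G a = H a) : classMean X Y b G = classMean X Y b H := by
  classical
  rw [classMean, classMean, Finset.sum_congr rfl fun a ha => h a (Finset.mem_filter.1 ha).2]

theorem classMean_const {X : RelStructure σ A} {Y : RelStructure σ B} {b : B}
    (hb : ∃ a, ElementEquiv X Y a b) (r : ℝ) : classMean X Y b (fun _ => r) = r := by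
  classical
  obtain ⟨a, ha⟩ := hb
  have h0 : (Finset.univ.filter fun a => ElementEquiv X Y a b).card ≠ 0 :=
    Finset.card_ne_zero_of_mem (Finset.mem_filter.2 ⟨Finset.mem_univ a, ha⟩)
  have h1 : ((Finset.univ.filter fun a => ElementEquiv X Y a b).card : ℝ) ≠ 0 :=
    Nat.cast_ne_zero.2 h0
  rw [classMean, Finset.sum_const, Finset.sum_const, nsmul_eq_mul, nsmul_eq_mul, mul_one,
    mul_div_cancel_left₀ _ h1]

theorem classMean_mono {X : RelStructure σ A} {Y : RelStructure σ B} {b : B} {G H : A → ℝ}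
    (h : ∀ a, ElementEquiv X Y a b → G a ≤ H a) : classMean X Y b G ≤ classMean X Y b H := by
  classical
  exact div_le_div_of_nonneg_right
    (Finset.sum_le_sum fun a ha => h a (Finset.mem_filter.1 ha).2)
    (Finset.sum_nonneg fun _ _ => zero_le_one)

theorem classMean_mem_Icc {X : RelStructure σ A} {Y : RelStructure σ B} {b : B}
    (hb : ∃ a, ElementEquiv X Y a b) {G : A → ℝ} {r s : ℝ}
    (h : ∀ a, ElementEquiv X Y a b → G a ∈ Set.Icc r s) :
    classMean X Y b G ∈ Set.Icc r s := by
  constructor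
  · rw [← classMean_const hb r]
    exact classMean_mono fun a ha => (h a ha).1
  · rw [← classMean_const hb s]
    exact classMean_mono fun a ha => (h a ha).2

end RelStructure

/-! ### Weights of words read along tuples -/

section WordMass

variable {B U V : Type*} [Fintype (V → B)] [Fintype (U → B)]

open Classical in
/-- The mass that a weight on functions `f : V → B` gives to a word `l`, when `f` is read along
the tuple `t`. -/
noncomputable def wordMass (r : (V → B) → ℝ) {n : ℕ} (t : Fin n → V) (l : List B) : ℝ :=
  ∑ f : V → B, if List.ofFn (f ∘ t) = l then r f else 0

open Classical in
theorem wordMass_ofFn (r : (V → B) → ℝ) {n : ℕ} (t : Fin n → V) (u : Fin n → B) :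
    wordMass r t (List.ofFn u) = ∑ f : V → B, if f ∘ t = u then r f else 0 := by
  simp only [wordMass, List.ofFn_inj]

theorem exists_of_wordMass_ne_zero {r : (V → B) → ℝ} {n : ℕ} {t : Fin n → V} {l : List B}
    (h : wordMass r t l ≠ 0) : ∃ f, List.ofFn (f ∘ t) = l ∧ r f ≠ 0 := by
  obtain ⟨f, -, hf⟩ := Finset.exists_ne_zero_of_sum_ne_zero h
  exact ⟨f, by simpa only [ne_eq, ite_eq_right_iff, Classical.not_imp] using hf⟩

/-- Along a surjective tuple at most one function reads as `l`, so the mass is a single value of `r`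
or zero. -/
theorem wordMass_mem_Icc {r : (V → B) → ℝ} {n : ℕ} {t : Fin n → V} (ht : Function.Surjective t)
    (hr : ∀ f, r f ∈ Set.Icc (0 : ℝ) 1) (l : List B) :
    wordMass r t l ∈ Set.Icc (0 : ℝ) 1 := by
  classical
  by_cases h : ∃ f : V → B, List.ofFn (f ∘ t) = l
  · obtain ⟨f, rfl⟩ := h
    have : wordMass r t (List.ofFn (f ∘ t)) = r f := by
      simp only [wordMass_ofFn, ht.injective_comp_right.eq_iff, Finset.sum_ite_eq',
        Finset.mem_univ, if_true]
    rw [this]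
    exact hr f
  · have : wordMass r t l = 0 :=
      Finset.sum_eq_zero fun f _ => if_neg fun hf => h ⟨f, hf⟩
    rw [this]
    exact ⟨le_rfl, zero_le_one⟩

theorem sum_wordMass (r : (V → B) → ℝ) {n : ℕ} (t : Fin n → V) [Fintype (Fin n → B)] :
    ∑ u : Fin n → B, wordMass r t (List.ofFn u) = ∑ f, r f := by
  classical
  simp only [wordMass_ofFn]
  rw [Finset.sum_comm]
  simp

/-- Both sides sum `rV g` over the `g` with `g ∘ t ∘ i = u`. -/
theorem wordMass_marginal [DecidableEq (U → B)] {rU : (U → B) → ℝ} {rV : (V → B) → ℝ}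
    (ρ : U → V) (h : ∀ f, rU f = ∑ g : V → B with g ∘ ρ = f, rV g) {m n : ℕ} {s : Fin m → U}
    {t : Fin n → V} {i : Fin m → Fin n} (hst : ρ ∘ s = t ∘ i) [Fintype (Fin n → B)]
    [DecidableEq (Fin m → B)] (u : Fin m → B) :
    wordMass rU s (List.ofFn u) =
      ∑ w : Fin n → B with w ∘ i = u, wordMass rV t (List.ofFn w) := by
  classical
  calc wordMass rU s (List.ofFn u)
      = ∑ f : U → B, ∑ g : V → B, if g ∘ ρ = f then (if f ∘ s = u then rV g else 0) else 0 := by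
        rw [wordMass_ofFn]
        refine Finset.sum_congr rfl fun f _ => ?_
        rw [h, Finset.sum_filter]
        split_ifs <;> simp
    _ = ∑ g : V → B, if g ∘ t ∘ i = u then rV g else 0 := by
        rw [Finset.sum_comm]
        refine Finset.sum_congr rfl fun g _ => ?_
        rw [Finset.sum_ite_eq, if_pos (Finset.mem_univ _), Function.comp_assoc, hst]
    _ = ∑ g : V → B, ∑ w : Fin n → B,
          if g ∘ t = w then (if w ∘ i = u then rV g else 0) else 0 := by
        refine Finset.sum_congr rfl fun g _ => ?_
        rw [Finset.sum_ite_eq, if_pos (Finset.mem_univ _), Function.comp_assoc]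
    _ = _ := by
        rw [Finset.sum_comm, Finset.sum_filter]
        refine Finset.sum_congr rfl fun w _ => ?_
        rw [wordMass_ofFn]
        split_ifs <;> simp

end WordMass

/-! ### From set-indexed solutions to tuple-indexed ones -/

namespace RelStructure

variable {σ : RelSignature.{u}} {A : Type v} {B : Type w} [Fintype B]

open Classical in
/-- Weights `M x l` of words `l` over the universe of `Y` at the elements `x` of `X^{*_k}`: a
Sherali-Adams solution that is indexed by tuples instead of sets. -/
structure IsStarMass (k : ℕ) (X : RelStructure σ A) (Y : RelStructure σ B)
    (M : X.StarUniverse k → List B → ℝ) : Prop where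
  mem_Icc : ∀ x l, M x l ∈ Set.Icc (0 : ℝ) 1
  sum_eq_one : ∀ (j : Fin k) (a : Fin (j.val + 1) → A),
    ∑ w : Fin (j.val + 1) → B, M (.inl ⟨j, a⟩) (List.ofFn w) = 1
  tuple_marginal : ∀ (j j' : Fin k) (i : Fin (j'.val + 1) → Fin (j.val + 1))
    (a : Fin (j.val + 1) → A) (u : Fin (j'.val + 1) → B),
    M (.inl ⟨j', a ∘ i⟩) (List.ofFn u) =
      ∑ w : Fin (j.val + 1) → B with w ∘ i = u, M (.inl ⟨j, a⟩) (List.ofFn w)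
  constraint_marginal : ∀ (R : σ.Symbol) (t : Fin (σ.arity R) → A) (ht : t ∈ X.rel R) (j : Fin k)
    (i : Fin (j.val + 1) → Fin (σ.arity R)) (u : Fin (j.val + 1) → B),
    M (.inl ⟨j, t ∘ i⟩) (List.ofFn u) =
      ∑ w : Fin (σ.arity R) → B with w ∘ i = u, M (.inr ⟨R, t, ht⟩) (List.ofFn w)
  mem_rel : ∀ (R : σ.Symbol) (t : Fin (σ.arity R) → A) (ht : t ∈ X.rel R)
    (w : Fin (σ.arity R) → B), M (.inr ⟨R, t, ht⟩) (List.ofFn w) ≠ 0 → w ∈ Y.rel R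
  eq_of_eq : ∀ (R : σ.Symbol) (t : Fin (σ.arity R) → A) (ht : t ∈ X.rel R)
    (w : Fin (σ.arity R) → B), M (.inr ⟨R, t, ht⟩) (List.ofFn w) ≠ 0 →
    ∀ m m', t m = t m' → w m = w m'

section OfSolution

open Classical in
/-- The set of the entries of a tuple. -/
noncomputable def tupleSupport {n : ℕ} (a : Fin n → A) : Finset A := Finset.univ.image a

theorem mem_tupleSupport {n : ℕ} (a : Fin n → A) (i : Fin n) : a i ∈ tupleSupport a := by
  classical
  exact Finset.mem_image_of_mem _ (Finset.mem_univ i)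

theorem surjective_tupleSupport {n : ℕ} (a : Fin n → A) :
    Function.Surjective fun i => (⟨a i, mem_tupleSupport a i⟩ : tupleSupport a) := by
  classical
  rintro ⟨x, hx⟩
  obtain ⟨i, -, rfl⟩ := Finset.mem_image.1 hx
  exact ⟨i, rfl⟩

theorem card_tupleSupport_le {n : ℕ} (a : Fin n → A) : (tupleSupport a).card ≤ n := by
  classical
  exact Finset.card_image_le.trans (Finset.card_fin n).le

open Classical in
/-- The weights of words that a Sherali-Adams solution induces. -/
noncomputable def starMass {k : ℕ} {X : RelStructure σ A}
    (p : (V : Finset A) → (V → B) → ℝ) (q : (c : X.Constraint) → (c.support → B) → ℝ) :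
    X.StarUniverse k → List B → ℝ
  | .inl ⟨_, a⟩, l => wordMass (p (tupleSupport a)) (fun i => ⟨a i, mem_tupleSupport a i⟩) l
  | .inr c, l => wordMass (q c) (fun i => ⟨c.tuple i, c.tuple_mem_support i⟩) l

theorem IsSASolution.isStarMass {k : ℕ} {X : RelStructure σ A} {Y : RelStructure σ B}
    {p : (V : Finset A) → (V → B) → ℝ} {q : (c : X.Constraint) → (c.support → B) → ℝ}
    (h : IsSASolution k X Y p q) : IsStarMass k X Y (starMass p q) := by
  classical
  have hne : ∀ (j : Fin k) (a : Fin (j.val + 1) → A), (tupleSupport a).Nonempty :=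
    fun j a => ⟨a 0, mem_tupleSupport a 0⟩
  have hle : ∀ (j : Fin k) (a : Fin (j.val + 1) → A), (tupleSupport a).card ≤ k :=
    fun j a => (card_tupleSupport_le a).trans j.isLt
  refine ⟨?_, ?_, ?_, ?_, ?_, ?_⟩
  · rintro (⟨j, a⟩ | c) l
    · exact wordMass_mem_Icc (surjective_tupleSupport a) (h.p_mem_Icc _ (hne j a) (hle j a)) l
    · exact wordMass_mem_Icc (surjective_tupleSupport c.tuple) (h.q_mem_Icc c) l
  · intro j a
    exact (sum_wordMass _ _).trans (h.sum_eq_one _ (hne j a) (hle j a))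
  · intro j j' i a u
    have hs : tupleSupport (a ∘ i) ⊆ tupleSupport a := by
      intro x hx
      obtain ⟨m, -, rfl⟩ := Finset.mem_image.1 hx
      exact mem_tupleSupport a (i m)
    have hm := h.marginal _ _ hs (hne j' _) (hle j a)
    exact wordMass_marginal (s := fun m => ⟨(a ∘ i) m, mem_tupleSupport (a ∘ i) m⟩)
      (t := fun m => ⟨a m, mem_tupleSupport a m⟩) (i := i)
      (fun x : tupleSupport (a ∘ i) => (⟨x.1, hs x.2⟩ : tupleSupport a)) hm rfl u
  · intro R t ht j i u
    have hs : tupleSupport (t ∘ i) ⊆ Constraint.support (⟨R, t, ht⟩ : X.Constraint) := by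
      intro x hx
      obtain ⟨m, -, rfl⟩ := Finset.mem_image.1 hx
      exact Constraint.tuple_mem_support (⟨R, t, ht⟩ : X.Constraint) (i m)
    have hm := h.marginal_constraint _ _ hs (hne j _) (hle j _)
    exact wordMass_marginal (s := fun m => ⟨(t ∘ i) m, mem_tupleSupport (t ∘ i) m⟩)
      (t := fun m => ⟨t m, Constraint.tuple_mem_support (⟨R, t, ht⟩ : X.Constraint) m⟩) (i := i)
      (fun x : tupleSupport (t ∘ i) =>
        (⟨x.1, hs x.2⟩ : Constraint.support (⟨R, t, ht⟩ : X.Constraint))) hm rfl u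
  · intro R t ht w hw
    obtain ⟨f, hf, hq⟩ := exists_of_wordMass_ne_zero hw
    rw [← List.ofFn_injective hf]
    by_contra hn
    exact hq (h.forbidden _ f hn)
  · intro R t ht w hw m m' hm
    obtain ⟨f, hf, hq⟩ := exists_of_wordMass_ne_zero hw
    rw [← List.ofFn_injective hf]
    exact congrArg f (Subtype.ext hm)

end OfSolution

/-! ### From tuple-indexed solutions back to set-indexed ones -/

section ToSolution

omit [Fintype B] in
theorem IsStarMass.exists_setMass {k : ℕ} {X : RelStructure σ A}
    (M : X.StarUniverse k → List B → ℝ) :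
    ∃ p : (V : Finset A) → (V → B) → ℝ, ∀ V : Finset A, V.Nonempty → V.card ≤ k →
      ∃ (j : Fin k) (e : Fin (j.val + 1) ≃ V), ∀ f,
        p V f = M (.inl ⟨j, fun m => (e m : A)⟩) (List.ofFn (f ∘ e)) := by
  have key : ∀ V : Finset A, ∃ r : (V → B) → ℝ, V.Nonempty → V.card ≤ k →
      ∃ (j : Fin k) (e : Fin (j.val + 1) ≃ V), ∀ f,
        r f = M (.inl ⟨j, fun m => (e m : A)⟩) (List.ofFn (f ∘ e)) := by
    intro V
    by_cases hV : V.Nonempty ∧ V.card ≤ k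
    · have hpos := hV.1.card_pos
      have hc : V.card - 1 + 1 = V.card := Nat.sub_add_cancel hpos
      -- The index `j` stands for length `j + 1`.
      let j : Fin k := ⟨V.card - 1, by omega⟩
      let e : Fin (j.val + 1) ≃ V := (finCongr hc).trans V.equivFin.symm
      exact ⟨fun f => M (.inl ⟨j, fun m => (e m : A)⟩) (List.ofFn (f ∘ e)),
        fun _ _ => ⟨j, e, fun _ => rfl⟩⟩
    · exact ⟨fun _ => 0, fun h1 h2 => absurd ⟨h1, h2⟩ hV⟩
  choose p hp using key
  exact ⟨p, hp⟩

/-- Sets are read along injective enumerations, so repeated entries matter only for constraints,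
where `eq_of_eq` controls them. -/
theorem IsStarMass.saFeasible {k : ℕ} {X : RelStructure σ A} {Y : RelStructure σ B}
    {M : X.StarUniverse k → List B → ℝ} (h : IsStarMass k X Y M) : SAFeasible k X Y := by
  classical
  obtain ⟨p, hp⟩ := exists_setMass M
  refine ⟨p, fun c f => M (.inr c) (List.ofFn fun i => f ⟨c.tuple i, c.tuple_mem_support i⟩),
    ?_, ?_, ?_, ?_, ?_, ?_⟩
  · intro V hV hk f
    obtain ⟨j, e, hf⟩ := hp V hV hk
    rw [hf]
    exact h.mem_Icc _ _
  · exact fun c f => h.mem_Icc _ _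
  · intro V hV hk
    obtain ⟨j, e, hf⟩ := hp V hV hk
    rw [← h.sum_eq_one j fun m => (e m : A)]
    refine Fintype.sum_equiv (e.symm.arrowCongr (Equiv.refl B)) _ _ fun f => ?_
    rw [hf]
    rfl
  · intro U V hUV hU hk f
    obtain ⟨j, e, hV⟩ := hp V (hU.mono hUV) hk
    obtain ⟨j', e', hU'⟩ := hp U hU ((Finset.card_le_card hUV).trans hk)
    let i : Fin (j'.val + 1) → Fin (j.val + 1) := fun m => e.symm ⟨e' m, hUV (e' m).2⟩
    have hi : (fun m => (e' m : A)) = (fun m => (e m : A)) ∘ i := by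
      funext m
      simp [i]
    rw [hU', hi, h.tuple_marginal]
    symm
    refine Finset.sum_equiv (e.symm.arrowCongr (Equiv.refl B)) (fun g => ?_) fun g _ => ?_
    · simp only [Finset.mem_filter, Finset.mem_univ, true_and]
      have : (e.symm.arrowCongr (Equiv.refl B)) g ∘ i =
          Finset.restrict₂ (π := fun _ => B) hUV g ∘ e' := by
        funext m
        simp [i]
      rw [this]
      exact e'.surjective.injective_comp_right.eq_iff.symm
    · rw [hV]
      rfl
  · rintro ⟨R, t, ht⟩ U hU hne hk f
    obtain ⟨j, e, hf⟩ := hp U hne hk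
    have hex : ∀ m, ∃ i, t i = e m := by
      intro m
      obtain ⟨i, -, hi⟩ := Finset.mem_image.1 (hU (e m).2)
      exact ⟨i, hi⟩
    choose i hi using hex
    have hi' : (fun m => (e m : A)) = t ∘ i := funext fun m => (hi m).symm
    have hsurj := surjective_tupleSupport t
    rw [hf, hi', h.constraint_marginal R t ht]
    symm
    -- Functions on the support correspond to words that respect the repetitions in `t`; all other
    -- words have mass zero by `eq_of_eq`.
    refine Finset.sum_of_injOn
      (fun g n => g ⟨t n, Constraint.tuple_mem_support (⟨R, t, ht⟩ : X.Constraint) n⟩) ?_ ?_ ?_ ?_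
    · exact fun g _ g' _ hg => hsurj.injective_comp_right hg
    · intro g hg
      have hg' := (Finset.mem_filter.1 hg).2
      refine Finset.mem_filter.2 ⟨Finset.mem_univ _, ?_⟩
      rw [← hg']
      funext m
      exact congrArg g (Subtype.ext (hi m))
    · intro w hw hn
      by_contra h0
      have heq := h.eq_of_eq R t ht w h0
      -- `ρ` picks a position for each entry; the choice is immaterial since `w` is constant on
      -- equal entries.
      obtain ⟨ρ, hρ⟩ := hsurj.hasRightInverse
      refine hn ⟨fun x => w (ρ x), Finset.mem_coe.2 (Finset.mem_filter.2
        ⟨Finset.mem_univ _, ?_⟩), ?_⟩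
      · funext x
        have hw' := congrFun (Finset.mem_filter.1 hw).2 (e.symm x)
        simp only [Function.comp_apply, Equiv.apply_symm_apply] at hw'
        rw [← hw']
        refine heq _ _ ?_
        rw [hi, e.apply_symm_apply]
        exact congrArg Subtype.val (hρ ⟨x, hU x.2⟩)
      · funext n
        exact heq _ _ (congrArg Subtype.val (hρ ⟨t n, mem_tupleSupport t n⟩))
    · exact fun _ _ => rfl
  · rintro ⟨R, t, ht⟩ f hf
    by_contra h0
    exact hf (h.mem_rel R t ht _ h0)

end ToSolution

/-! ### Transfer by averaging -/

section Transfer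

variable {A' : Type*} {k : ℕ} {X : RelStructure σ A} {X' : RelStructure σ A'}
  [Fintype (X.StarUniverse k)] [Fintype (X'.StarUniverse k)]

theorem exists_of_classMean_ne_zero {τ : RelSignature.{u}} {C : Type*} {D : Type*} [Fintype C]
    [Fintype D] {S : RelStructure τ C} {T : RelStructure τ D} {d : D} {G : C → ℝ}
    (h : classMean S T d G ≠ 0) : ∃ c, ElementEquiv S T c d ∧ G c ≠ 0 := by
  by_contra! hn
  refine h ?_
  rw [classMean_congr hn]
  simp [classMean]

/-- `T_{j,∅}` holds of exactly the tuples with length index `j`, so the colour determines the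
length. -/
theorem exists_tuple_of_elementEquiv {x : X.StarUniverse k} {j : Fin k}
    {a' : Fin (j.val + 1) → A'} (h : ElementEquiv (X.star k) (X'.star k) x (.inl ⟨j, a'⟩)) :
    ∃ a, x = .inl ⟨j, a⟩ := by
  obtain ⟨s, ⟨a, -, rfl⟩, hs⟩ := h.symm.exists_mem_rel
    (R := RelSignature.StarSymbol.tupleEq j ∅) (t := (![.inl ⟨j, a'⟩] : Fin 1 → _))
    (i := (0 : Fin 1)) ⟨a', by simp, rfl⟩ rfl
  exact ⟨a, hs.symm⟩

/-- Membership in `R_S` is a colour invariant; it records the symbol and the coincidences of entries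
on `S`. -/
theorem exists_constraint_of_elementEquiv {x : X.StarUniverse k} {R : σ.Symbol}
    {t' : Fin (σ.arity R) → A'} {ht' : t' ∈ X'.rel R}
    (h : ElementEquiv (X.star k) (X'.star k) x (.inr ⟨R, t', ht'⟩))
    {S : Finset (Fin (σ.arity R))} (hS : ∀ m ∈ S, ∀ m' ∈ S, t' m = t' m') :
    ∃ (t : Fin (σ.arity R) → A) (ht : t ∈ X.rel R),
      x = .inr ⟨R, t, ht⟩ ∧ ∀ m ∈ S, ∀ m' ∈ S, t m = t m' := by
  obtain ⟨s, ⟨t, ht, hS', rfl⟩, hs⟩ := h.symm.exists_mem_rel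
    (R := RelSignature.StarSymbol.constraintEq R S) (t := (![.inr ⟨R, t', ht'⟩] : Fin 1 → _))
    (i := (0 : Fin 1)) ⟨t', ht', hS, rfl⟩ rfl
  exact ⟨t, ht, hs.symm, hS'⟩

theorem IsStarMass.classMean {Y : RelStructure σ B} {M : X.StarUniverse k → List B → ℝ}
    (hM : IsStarMass k X Y M) (h : SameIterDegreeSequence (X.star k) (X'.star k)) :
    IsStarMass k X' Y fun x l => classMean (X.star k) (X'.star k) x fun y => M y l := by
  classical
  refine ⟨?_, ?_, ?_, ?_, ?_, ?_⟩
  · exact fun x l => classMean_mem_Icc (h.exists_elementEquiv x) fun y _ => hM.mem_Icc y l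
  · intro j a
    rw [← classMean_sum, ← classMean_const (h.exists_elementEquiv (.inl ⟨j, a⟩)) 1]
    refine classMean_congr fun x hx => ?_
    obtain ⟨b, rfl⟩ := exists_tuple_of_elementEquiv hx
    exact hM.sum_eq_one j b
  · intro j j' i a u
    rw [← classMean_sum]
    refine classMean_eq_of_mem_rel (X.star k) (X'.star k)
      (R := RelSignature.StarSymbol.tupleProj j j' i)
      -- The projected tuple is at position `1` of the pair and the full tuple at position `0`.
      (s := (![.inl ⟨j, a⟩, .inl ⟨j', a ∘ i⟩] : Fin 2 → _)) ⟨a, rfl⟩ (1 : Fin 2) (0 : Fin 2) ?_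
    rintro _ ⟨b, rfl⟩
    exact hM.tuple_marginal j j' i b u
  · intro R t ht j i u
    rw [← classMean_sum]
    refine classMean_eq_of_mem_rel (X.star k) (X'.star k)
      (R := RelSignature.StarSymbol.constraintProj R j i)
      (s := (![.inr ⟨R, t, ht⟩, .inl ⟨j, t ∘ i⟩] : Fin 2 → _)) ⟨t, ht, rfl⟩
      (1 : Fin 2) (0 : Fin 2) ?_
    rintro _ ⟨s, hs, rfl⟩
    exact hM.constraint_marginal R s hs j i u
  · intro R t ht w hw
    -- A nonzero mean has a nonzero term, so the support conditions are inherited from one node of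
    -- the class.
    obtain ⟨x, hx, h0⟩ := exists_of_classMean_ne_zero hw
    obtain ⟨s, hs, rfl, -⟩ := exists_constraint_of_elementEquiv hx (S := ∅) (by simp)
    exact hM.mem_rel R s hs w h0
  · intro R t ht w hw m m' hm
    obtain ⟨x, hx, h0⟩ := exists_of_classMean_ne_zero hw
    obtain ⟨s, hs, rfl, he⟩ := exists_constraint_of_elementEquiv hx (S := {m, m'})
      (by simp [hm])
    exact hM.eq_of_eq R s hs w h0 m m' (he m (by simp) m' (by simp))

theorem SAFeasible.of_sameIterDegreeSequence {Y : RelStructure σ B}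
    (h : SameIterDegreeSequence (X.star k) (X'.star k)) (hX : SAFeasible k X Y) :
    SAFeasible k X' Y := by
  obtain ⟨p, q, hpq⟩ := hX
  exact (hpq.isStarMass.classMean h).saFeasible

end Transfer

end RelStructure

theorem mainTheorem6 {σ : RelSignature.{u}} {A : Type*} {A' : Type*} {B : Type*}
    [Fintype A] [Fintype A'] [Fintype B]
    (k : ℕ) (hk : 1 ≤ k)
    (X : RelStructure σ A) (X' : RelStructure σ A') (hWL : RelStructure.EqWL k X X')
    (Y : RelStructure σ B) :
    RelStructure.SAFeasible k X Y ↔ RelStructure.SAFeasible k X' Y :=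
  ⟨.of_sameIterDegreeSequence hWL, .of_sameIterDegreeSequence fun n => (hWL n).symm⟩
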